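/- Let $I=[0,1]$, let $e_0,e_1\colon *\to I$ be the inclusions of the endpoints $0$ and $1$, and let $a,b\colon I\to I$ be $a(t)=t/2$ and $b(t)=(t+1)/2$. Write $\Omega X$ for the frame of open sets of a space $X$, and also for the corresponding object of the category $\mathbf{Loc}=\mathbf{Frm}^{op}$ of locales; a continuous map $f\colon X\to Y$ gives the frame homomorphism $f^{-1}\colon \Omega Y\to\Omega X$, that is, a morphism $\Omega f\colon\Omega X\to\Omega Y$ of $\mathbf{Loc}$. For frames $L,M$ let $L\otimes M$ be their coproduct in $\mathbf{Frm}$, realized as the frame of those downsets $S\subseteq L\times M$ that are closed under arbitrary (possibly empty) joins in each variable separately. For $k=0,1$ let $\chi_k\colon L\otimes\Omega I\to L$ be $\mathrm{id}_L\otimes e_k^{-1}\colon L\otimes\Omega I\to L\otimes\Omega *$ followed by the canonical isomorphism $L\otimes\Omega *=L\otimes\{0<1\}\cong L$. **Proposition.** (1) For every frame $L$, the square $$\begin{array}{ccc} L\otimes\Omega I & \xrightarrow{\ \mathrm{id}_L\otimes a^{-1}\ } & L\otimes\Omega I\\ {\scriptstyle \mathrm{id}_L\otimes b^{-1}}\downarrow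 & & \downarrow{\scriptstyle \chi_1}\\ L\otimes\Omega I & \xrightarrow{\ \ \chi_0\ \ } & L\end{array}$$ is a pullback square in $\mathbf{Frm}$. (2) Dually, axiom (S3) of a category with intervals holds for $(\mathbf{Loc},\Omega)$: one has $a(0)=0$ and $b(1)=1$; the square with $a\circ e_1=b\circ e_0$ exhibits $I$ as the pushout $I\sqcup_* I$ of $I\xleftarrow{e_1}*\xrightarrow{e_0}I$ in topological spaces; $\Omega$ sends this square to a pushout square in $\mathbf{Loc}$; and for every locale $L$ the functor $L\times-\colon\mathbf{Loc}\to\mathbf{Loc}$ preserves the pushout of $\Omega I\xleftarrow{\Omega e_1}\Omega *\xrightarrow{\Omega e_0}\Omega I$, so that the square with $(\mathrm{id}_L\times\Omega a)\circ(\mathrm{id}_L\times\Omega e_1)=(\mathrm{id}_L\times\Omega b)\circ(\mathrm{id}_L\times\Omega e_0)$ is a pushout in $\mathbf{Loc}$. -/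

import Mathlib

open CategoryTheory CategoryTheory.Limits TopologicalSpace

universe u v w

/-- The coproduct `L ⊗ M` of two frames: the downsets of `L × M` that are saturated, i.e. closed
under arbitrary (possibly empty) joins in each variable separately, ordered by inclusion. -/
@[ext]
structure FrameTensor (L : Type u) (M : Type v) [Order.Frame L] [Order.Frame M] where
  carrier : Set (L × M)
  lower : IsLowerSet carrier
  sSup_left_mem : ∀ (X : Set L) (y : M), (∀ x ∈ X, (x, y) ∈ carrier) → (sSup X, y) ∈ carrier
  sSup_right_mem : ∀ (x : L) (Y : Set M), (∀ y ∈ Y, (x, y) ∈ carrier) → (x, sSup Y) ∈ carrier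

namespace FrameTensor

section Basic

variable {L : Type u} {M : Type v} {N : Type w} [Order.Frame L] [Order.Frame M] [Order.Frame N]

instance : PartialOrder (FrameTensor L M) :=
  PartialOrder.lift FrameTensor.carrier (fun _ _ h => FrameTensor.ext h)

theorem le_def {S T : FrameTensor L M} : S ≤ T ↔ S.carrier ⊆ T.carrier := Iff.rfl

/-- Meets of saturated downsets are intersections. -/
instance : InfSet (FrameTensor L M) where
  sInf 𝒮 :=
    { carrier := {p | ∀ S ∈ 𝒮, p ∈ S.carrier}
      lower := fun _ _ hqp hp S hS => S.lower hqp (hp S hS)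
      sSup_left_mem := fun X y h S hS => S.sSup_left_mem X y fun x hx => h x hx S hS
      sSup_right_mem := fun x Y h S hS => S.sSup_right_mem x Y fun y hy => h y hy S hS }

theorem isGLB_sInf' (𝒮 : Set (FrameTensor L M)) : IsGLB 𝒮 (sInf 𝒮) :=
  ⟨fun _ hS _ hp => hp _ hS, fun _ hT _ hp _ hS => hT hS hp⟩

instance : CompleteLattice (FrameTensor L M) where
  __ := completeLatticeOfInf (FrameTensor L M) isGLB_sInf'
  inf S T :=
    { carrier := S.carrier ∩ T.carrier
      lower := S.lower.inter T.lower
      sSup_left_mem := fun X y h =>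
        ⟨S.sSup_left_mem X y fun x hx => (h x hx).1, T.sSup_left_mem X y fun x hx => (h x hx).2⟩
      sSup_right_mem := fun x Y h =>
        ⟨S.sSup_right_mem x Y fun y hy => (h y hy).1,
          T.sSup_right_mem x Y fun y hy => (h y hy).2⟩ }
  inf_le_left _ _ _ hp := hp.1
  inf_le_right _ _ _ hp := hp.2
  le_inf _ _ _ h₁ h₂ _ hp := ⟨h₁ hp, h₂ hp⟩
  top :=
    { carrier := Set.univ
      lower := isLowerSet_univ
      sSup_left_mem := fun _ _ _ => trivial
      sSup_right_mem := fun _ _ _ => trivial }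
  le_top _ _ _ := trivial

theorem inf_sSup_le' (S : FrameTensor L M) (𝒯 : Set (FrameTensor L M)) :
    S ⊓ sSup 𝒯 ≤ ⨆ T ∈ 𝒯, S ⊓ T := by
  set W : FrameTensor L M := ⨆ T ∈ 𝒯, S ⊓ T with hW
  let R : FrameTensor L M :=
    { carrier := {p | ∀ q ≤ p, q ∈ S.carrier → q ∈ W.carrier}
      lower := fun _ _ hqp hp r hr => hp r (hr.trans hqp)
      sSup_left_mem := by
        rintro X y h ⟨a, b⟩ ⟨ha, hb⟩ hS
        have key := W.sSup_left_mem ((fun x => a ⊓ x) '' X) b (by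
          rintro _ ⟨x, hx, rfl⟩
          exact h x hx (a ⊓ x, b) ⟨inf_le_right, hb⟩ (S.lower (a := (a, b)) ⟨inf_le_left, le_rfl⟩ hS))
        rwa [sSup_image, ← inf_sSup_eq, inf_eq_left.2 ha] at key
      sSup_right_mem := by
        rintro x Y h ⟨a, b⟩ ⟨ha, hb⟩ hS
        have key := W.sSup_right_mem a ((fun y => b ⊓ y) '' Y) (by
          rintro _ ⟨y, hy, rfl⟩
          exact h y hy (a, b ⊓ y) ⟨ha, inf_le_right⟩ (S.lower (a := (a, b)) ⟨le_rfl, inf_le_left⟩ hS))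
        rwa [sSup_image, ← inf_sSup_eq, inf_eq_left.2 hb] at key }
  have hR : sSup 𝒯 ≤ R := sSup_le fun T hT p hp q hq hqS =>
    (le_iSup₂_of_le (f := fun T (_ : T ∈ 𝒯) => S ⊓ T) T hT le_rfl : S ⊓ T ≤ W)
      ⟨hqS, T.lower hq hp⟩
  exact fun p hp => hR hp.2 p le_rfl hp.1

instance : Order.Frame (FrameTensor L M) :=
  Order.Frame.ofMinimalAxioms ⟨inf_sSup_le'⟩

/-- The element `x ⊗ y`, i.e. the downset generated by `(x, y)` together with all pairs having a
bottom component. -/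
def tmul (x : L) (y : M) : FrameTensor L M where
  carrier := {p | (p.1 ≤ x ∧ p.2 ≤ y) ∨ p.1 = ⊥ ∨ p.2 = ⊥}
  lower := by
    rintro ⟨a, b⟩ ⟨c, d⟩ ⟨h₁, h₂⟩ (⟨h₃, h₄⟩ | h | h)
    · exact Or.inl ⟨h₁.trans h₃, h₂.trans h₄⟩
    · exact Or.inr (Or.inl (le_bot_iff.1 (h₁.trans_eq h)))
    · exact Or.inr (Or.inr (le_bot_iff.1 (h₂.trans_eq h)))
  sSup_left_mem := by
    intro X b h
    by_cases hb : b = ⊥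
    · exact Or.inr (Or.inr hb)
    by_cases hX : sSup X = ⊥
    · exact Or.inr (Or.inl hX)
    obtain ⟨c, hc, hc'⟩ : ∃ c ∈ X, c ≠ ⊥ := by
      by_contra! H
      exact hX (sSup_eq_bot.2 H)
    refine Or.inl ⟨sSup_le fun c hc => ?_, ?_⟩
    · rcases h c hc with h | h | h
      · exact h.1
      · exact (show c = ⊥ from h) ▸ bot_le
      · exact absurd h hb
    · rcases h c hc with h | h | h
      · exact h.2
      · exact absurd h hc'
      · exact absurd h hb
  sSup_right_mem := by
    intro a Y h
    by_cases ha : a = ⊥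
    · exact Or.inr (Or.inl ha)
    by_cases hY : sSup Y = ⊥
    · exact Or.inr (Or.inr hY)
    obtain ⟨c, hc, hc'⟩ : ∃ c ∈ Y, c ≠ ⊥ := by
      by_contra! H
      exact hY (sSup_eq_bot.2 H)
    refine Or.inl ⟨?_, sSup_le fun c hc => ?_⟩
    · rcases h c hc with h | h | h
      · exact h.1
      · exact absurd h ha
      · exact absurd h hc'
    · rcases h c hc with h | h | h
      · exact h.2
      · exact absurd h ha
      · exact (show c = ⊥ from h) ▸ bot_le

theorem bot_left_mem (S : FrameTensor L M) (y : M) : ((⊥ : L), y) ∈ S.carrier := by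
  simpa using S.sSup_left_mem ∅ y (by simp)

theorem bot_right_mem (S : FrameTensor L M) (x : L) : (x, (⊥ : M)) ∈ S.carrier := by
  simpa using S.sSup_right_mem x ∅ (by simp)

theorem tmul_le {x : L} {y : M} {S : FrameTensor L M} : tmul x y ≤ S ↔ (x, y) ∈ S.carrier := by
  refine ⟨fun h => h (Or.inl ⟨le_rfl, le_rfl⟩), ?_⟩
  rintro h ⟨a, b⟩ (⟨ha, hb⟩ | ha | hb)
  · exact S.lower ⟨ha, hb⟩ h
  · exact (show a = ⊥ from ha) ▸ S.bot_left_mem b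
  · exact (show b = ⊥ from hb) ▸ S.bot_right_mem a

theorem tmul_inf_tmul (x x' : L) (y y' : M) :
    tmul x y ⊓ tmul x' y' = tmul (x ⊓ x') (y ⊓ y') := by
  apply le_antisymm
  · rintro ⟨a, b⟩ ⟨h | h | h, h' | h' | h'⟩
    · exact Or.inl ⟨le_inf h.1 h'.1, le_inf h.2 h'.2⟩
    all_goals first | exact Or.inr (Or.inl (by assumption)) | exact Or.inr (Or.inr (by assumption))
  · exact le_inf (tmul_le.2 (Or.inl ⟨inf_le_left, inf_le_left⟩))
      (tmul_le.2 (Or.inl ⟨inf_le_right, inf_le_right⟩))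

theorem sSup_tmul (X : Set L) (y : M) : tmul (sSup X) y = sSup ((fun x => tmul x y) '' X) := by
  apply le_antisymm
  · exact tmul_le.2 (FrameTensor.sSup_left_mem _ X y fun x hx =>
      tmul_le.1 (le_sSup (Set.mem_image_of_mem _ hx)))
  · refine sSup_le ?_
    rintro _ ⟨x, hx, rfl⟩
    exact tmul_le.2 (Or.inl ⟨le_sSup hx, le_rfl⟩)

theorem tmul_sSup (x : L) (Y : Set M) : tmul x (sSup Y) = sSup ((fun y => tmul x y) '' Y) := by
  apply le_antisymm
  · exact tmul_le.2 (FrameTensor.sSup_right_mem _ x Y fun y hy =>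
      tmul_le.1 (le_sSup (Set.mem_image_of_mem _ hy)))
  · refine sSup_le ?_
    rintro _ ⟨y, hy, rfl⟩
    exact tmul_le.2 (Or.inl ⟨le_rfl, le_sSup hy⟩)

theorem eq_iSup_tmul (S : FrameTensor L M) : S = ⨆ p ∈ S.carrier, tmul p.1 p.2 := by
  apply le_antisymm
  · intro p hp
    exact tmul_le.1 (le_iSup₂ (f := fun (p : L × M) (_ : p ∈ S.carrier) => tmul p.1 p.2) p hp)
  · exact iSup₂_le fun p hp => tmul_le.2 hp

/-- The first coproduct inclusion `x ↦ x ⊗ 1`. -/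
def inl : FrameHom L (FrameTensor L M) where
  toFun x := tmul x ⊤
  map_inf' x x' := by simp [tmul_inf_tmul]
  map_top' := top_le_iff.1 fun _ _ => Or.inl ⟨le_top, le_top⟩
  map_sSup' X := sSup_tmul X ⊤

/-- The second coproduct inclusion `y ↦ 1 ⊗ y`. -/
def inr : FrameHom M (FrameTensor L M) where
  toFun y := tmul ⊤ y
  map_inf' y y' := by simp [tmul_inf_tmul]
  map_top' := top_le_iff.1 fun _ _ => Or.inl ⟨le_top, le_top⟩
  map_sSup' Y := tmul_sSup ⊤ Y

theorem inl_inf_inr (x : L) (y : M) : (inl x : FrameTensor L M) ⊓ inr y = tmul x y := by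
  change tmul x ⊤ ⊓ tmul ⊤ y = tmul x y
  simp [tmul_inf_tmul]

theorem lift_gc (f : FrameHom L N) (g : FrameHom M N) :
    ∃ r : N → FrameTensor L M,
      GaloisConnection (fun S : FrameTensor L M => ⨆ p ∈ S.carrier, f p.1 ⊓ g p.2) r := by
  refine ⟨fun n =>
    { carrier := {p | f p.1 ⊓ g p.2 ≤ n}
      lower := fun p q h hp => (inf_le_inf (OrderHomClass.mono f h.1)
        (OrderHomClass.mono g h.2)).trans hp
      sSup_left_mem := fun X y h => ?_
      sSup_right_mem := fun x Y h => ?_ }, fun S n => ?_⟩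
  · change f (sSup X) ⊓ g y ≤ n
    rw [map_sSup, sSup_inf_eq]
    refine iSup₂_le ?_
    rintro _ ⟨x, hx, rfl⟩
    exact h x hx
  · change f x ⊓ g (sSup Y) ≤ n
    rw [map_sSup, inf_sSup_eq]
    refine iSup₂_le ?_
    rintro _ ⟨y, hy, rfl⟩
    exact h y hy
  · exact iSup₂_le_iff

/-- The frame homomorphism out of the coproduct induced by `f` and `g`; it sends `x ⊗ y` to
`f x ⊓ g y`. -/
def lift (f : FrameHom L N) (g : FrameHom M N) : FrameHom (FrameTensor L M) N where
  toFun S := ⨆ p ∈ S.carrier, f p.1 ⊓ g p.2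
  map_inf' S T := by
    apply le_antisymm
    · exact le_inf (biSup_mono fun _ hp => hp.1) (biSup_mono fun _ hp => hp.2)
    · simp only [iSup_inf_eq, inf_iSup_eq]
      refine iSup₂_le fun p hp => iSup₂_le fun q hq => ?_
      refine le_iSup₂_of_le (p ⊓ q) ?_ ?_
      · first
          | exact ⟨S.lower inf_le_left hp, T.lower inf_le_right hq⟩
          | exact ⟨S.lower inf_le_right hq, T.lower inf_le_left hp⟩
      · simp only [Prod.fst_inf, Prod.snd_inf, map_inf]
        exact le_of_eq (by ac_rfl)
  map_top' := top_le_iff.1 (le_iSup₂_of_le (⊤, ⊤) trivial (by simp))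
  map_sSup' 𝒮 := by
    obtain ⟨r, hr⟩ := lift_gc f g
    rw [hr.l_sSup, sSup_image]

theorem lift_tmul (f : FrameHom L N) (g : FrameHom M N) (x : L) (y : M) :
    lift f g (tmul x y) = f x ⊓ g y := by
  apply le_antisymm
  · refine iSup₂_le ?_
    rintro ⟨a, b⟩ (⟨ha, hb⟩ | ha | hb)
    · exact inf_le_inf (OrderHomClass.mono f ha) (OrderHomClass.mono g hb)
    · simp [show a = ⊥ from ha]
    · simp [show b = ⊥ from hb]
  · exact le_iSup₂_of_le (f := fun (p : L × M) (_ : p ∈ (tmul x y).carrier) => f p.1 ⊓ g p.2)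
      (x, y) (Or.inl ⟨le_rfl, le_rfl⟩) le_rfl

theorem lift_inl (f : FrameHom L N) (g : FrameHom M N) (x : L) : lift f g (inl x) = f x :=
  (lift_tmul f g x ⊤).trans (by simp)

theorem lift_inr (f : FrameHom L N) (g : FrameHom M N) (y : M) : lift f g (inr y) = g y :=
  (lift_tmul f g ⊤ y).trans (by simp)

theorem hom_ext' {h k : FrameHom (FrameTensor L M) N} (hl : ∀ x, h (inl x) = k (inl x))
    (hr : ∀ y, h (inr y) = k (inr y)) : h = k := by
  ext S
  rw [eq_iSup_tmul S]
  simp only [map_iSup, ← inl_inf_inr, map_inf, hl, hr]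

/-- `id ⊗ g : L ⊗ M → L ⊗ N` for a frame homomorphism `g : M → N`. -/
def lTensor (L : Type u) [Order.Frame L] (g : FrameHom M N) :
    FrameHom (FrameTensor L M) (FrameTensor L N) :=
  lift inl (inr.comp g)

end Basic

section Unit

variable (L : Type u) [Order.Frame L]

/-- The unique frame homomorphism from the opens of the point (the two-element frame) to `L`. -/
def fromPoint : FrameHom (Opens PUnit.{v + 1}) L where
  toFun U := ⨆ _ : PUnit.unit ∈ U, ⊤
  map_inf' U V := by
    by_cases hU : PUnit.unit ∈ U <;> by_cases hV : PUnit.unit ∈ V <;> simp [hU, hV]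
  map_top' := by simp
  map_sSup' 𝒰 := by
    rw [sSup_image]
    simp only [Opens.mem_sSup, iSup_exists, iSup_and]

theorem inl_lift_fromPoint (S : FrameTensor L (Opens PUnit.{v + 1})) :
    inl (lift (FrameHom.id L) (fromPoint L) S) = S := by
  have h : (inl.comp (lift (FrameHom.id L) (fromPoint.{u, v} L))) = FrameHom.id _ := by
    refine hom_ext' (fun x => ?_) (fun U => ?_)
    · simp [lift_inl]
    · simp only [FrameHom.comp_apply, lift_inr, FrameHom.id_apply]
      by_cases hU : PUnit.unit ∈ U
      · obtain rfl : U = ⊤ := by ext x; simpa using hU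
        simp
      · obtain rfl : U = ⊥ := by ext x; simpa using hU
        simp
  exact DFunLike.congr_fun h S

/-- The identification of `L ⊗ {0 < 1}` with `L`, where `{0 < 1}` is the frame of opens of the
point. -/
def rightUnit : FrameTensor L (Opens PUnit.{v + 1}) ≃o L where
  toFun := lift (FrameHom.id L) (fromPoint L)
  invFun := inl
  left_inv S := inl_lift_fromPoint L S
  right_inv x := by simp [lift_inl]
  map_rel_iff' := by
    intro S T
    refine ⟨fun h => ?_, fun h => OrderHomClass.mono (lift (FrameHom.id L) (fromPoint L)) h⟩
    rw [← inl_lift_fromPoint L S, ← inl_lift_fromPoint L T]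
    exact OrderHomClass.mono inl h

end Unit

/-- `FrameTensor L M` with its two inclusions is a coproduct in the category of frames. -/
def isColimit (L M : Frm.{u}) :
    IsColimit (BinaryCofan.mk (P := Frm.of (FrameTensor L M)) (Frm.ofHom inl) (Frm.ofHom inr)) :=
  BinaryCofan.IsColimit.mk _
    (fun {N} f g => Frm.ofHom (Y := N) (lift (N := N) f.hom g.hom))
    (fun {_} f g => Frm.ext fun x => lift_inl f.hom g.hom x)
    (fun {_} f g => Frm.ext fun y => lift_inr f.hom g.hom y)
    (fun {N} f g _ h₁ h₂ => Frm.hom_ext <| hom_ext' (N := N)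
      (fun x => (DFunLike.congr_fun (congrArg Frm.Hom.hom h₁) x).trans
        (lift_inl f.hom g.hom x).symm)
      (fun y => (DFunLike.congr_fun (congrArg Frm.Hom.hom h₂) y).trans
        (lift_inr f.hom g.hom y).symm))

end FrameTensor

instance : HasBinaryCoproducts Frm.{u} :=
  have (X Y : Frm.{u}) : HasColimit (pair X Y) := ⟨⟨⟨_, FrameTensor.isColimit X Y⟩⟩⟩
  hasBinaryCoproducts_of_hasColimit_pair _

instance : HasBinaryProducts Locale.{u} :=
  inferInstanceAs (HasBinaryProducts Frm.{u}ᵒᵖ)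

namespace UnitInterval

/-- The one-point space. -/
abbrev pt : TopCat.{u} := TopCat.of PUnit.{u + 1}

/-- The endpoint inclusion `e₀ : * → I` with value `0`. -/
def e₀ : pt.{u} ⟶ TopCat.I.{u} := TopCat.ofHom (ContinuousMap.const _ 0)

/-- The endpoint inclusion `e₁ : * → I` with value `1`. -/
def e₁ : pt.{u} ⟶ TopCat.I.{u} := TopCat.ofHom (ContinuousMap.const _ 1)

/-- `a : I → I`, `a t = t / 2`. -/
noncomputable def a : TopCat.I.{u} ⟶ TopCat.I.{u} :=
  TopCat.ofHom
    { toFun := fun t => TopCat.I.homeomorph.symm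
        ⟨(TopCat.I.homeomorph t : ℝ) / 2, by
          have h := (TopCat.I.homeomorph t).2
          constructor <;> linarith [h.1, h.2]⟩
      continuous_toFun := by fun_prop }

/-- `b : I → I`, `b t = (t + 1) / 2`. -/
noncomputable def b : TopCat.I.{u} ⟶ TopCat.I.{u} :=
  TopCat.ofHom
    { toFun := fun t => TopCat.I.homeomorph.symm
        ⟨((TopCat.I.homeomorph t : ℝ) + 1) / 2, by
          have h := (TopCat.I.homeomorph t).2
          constructor <;> linarith [h.1, h.2]⟩
      continuous_toFun := by fun_prop }

/-- The map `χ : L ⊗ ΩI → L` at an endpoint `e : * → I`: the map `id ⊗ e⁻¹ : L ⊗ ΩI → L ⊗ Ω*`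
followed by the identification of `L ⊗ Ω*` with `L`. -/
def chi (L : Type u) [Order.Frame L] (e : pt.{u} ⟶ TopCat.I.{u}) :
    FrameHom (FrameTensor L (Opens TopCat.I.{u})) L :=
  (FrameTensor.rightUnit L : FrameHom (FrameTensor L (Opens PUnit.{u + 1})) L).comp
    (FrameTensor.lTensor L (Opens.comap e.hom))

end UnitInterval

/-! The halves of `I` are closed, cover `I` and meet in one point, so on opens they are closed
quotients by `u` and `v` with `u ⊓ v = ⊥`, and their common quotient is the one by `u ⊔ v`. By
distributivity, any frame is the pullback of two such quotients over the common one (`isPullback`).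

The gluing survives tensoring because a closed quotient by `m` becomes a closed quotient by `1 ⊗ m`
(`lTensor`), and `m ↦ 1 ⊗ m` is a frame homomorphism, hence preserves the relations between `u` and
`v`. No condition on `L` is needed. Reversing arrows and identifying products of locales with frame
tensors yields the pushouts; the pushout of spaces is the pasting lemma for closed covers. -/

/-- `g : M → N` is the quotient map onto the closed sublocale complementary to `m`: up to
isomorphism it is `M → ↑m`, `y ↦ y ⊔ m`. -/
structure FrameHom.IsClosedQuotient {M : Type u} {N : Type v} [Order.Frame M] [Order.Frame N]
    (g : FrameHom M N) (m : M) : Prop where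
  surjective : Function.Surjective g
  map_eq_bot : g m = ⊥
  le_sup_of_map_le : ∀ {y y' : M}, g y ≤ g y' → y ≤ y' ⊔ m

namespace FrameHom.IsClosedQuotient

/-! ### Stability of closed quotients under tensoring. -/

section Tensor

variable {M : Type v} {N : Type w} [Order.Frame M] [Order.Frame N] {g : FrameHom M N} {m : M}

/-- For a closed quotient map `g`, the transport of a saturated downset of `L × M` containing
`1 ⊗ m` to a saturated downset of `L × N`. -/
def pushTensor (hg : g.IsClosedQuotient m) {L : Type u} [Order.Frame L] (S : FrameTensor L M)
    (hS : FrameTensor.inr m ≤ S) : FrameTensor L N where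
  carrier := {p | ∀ y, g y ≤ p.2 → (p.1, y) ∈ S.carrier}
  lower := fun p q hqp hp y hy =>
    S.lower (a := (p.1, y)) ⟨hqp.1, le_rfl⟩ (hp y (hy.trans hqp.2))
  sSup_left_mem := fun X _ h y hy => S.sSup_left_mem X y fun x hx => h x hx y hy
  sSup_right_mem := fun x Y h y hy => by
    have hm : (x, m) ∈ S.carrier :=
      S.lower (a := (⊤, m)) ⟨le_top, le_rfl⟩ (FrameTensor.tmul_le.1 hS)
    -- An element whose image lies below `sSup Y` lies below the join of lifts of members of `Y`
    -- only up to `m`. Adjoining `m` to the family absorbs the defect.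
    have key := S.sSup_right_mem x ({z | ∃ n ∈ Y, g z ≤ n} ∪ {m}) (by
      rintro z (⟨n, hn, hz⟩ | rfl)
      · exact h n hn z hz
      · exact hm)
    refine S.lower (a := (x, sSup _)) (b := (x, y)) ⟨le_rfl, ?_⟩ key
    rw [sSup_union, sSup_singleton]
    refine hg.le_sup_of_map_le (hy.trans (sSup_le fun n hn => ?_))
    obtain ⟨z, rfl⟩ := hg.surjective n
    exact OrderHomClass.mono g (le_sSup ⟨_, hn, le_rfl⟩)

/-- Surjectivity comes from lifting generators. The order condition needs no formula for the join
with `1 ⊗ m`: `pushTensor` supplies a saturated downset that bounds the image from above. -/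
theorem lTensor (hg : g.IsClosedQuotient m) (L : Type u) [Order.Frame L] :
    (FrameTensor.lTensor L g).IsClosedQuotient (FrameTensor.inr m) where
  surjective T := by
    refine ⟨⨆ p ∈ {p : L × M | (p.1, g p.2) ∈ T.carrier}, FrameTensor.tmul p.1 p.2, ?_⟩
    rw [FrameTensor.eq_iSup_tmul T]
    simp only [map_iSup, FrameTensor.lTensor, FrameTensor.lift_tmul, FrameHom.comp_apply,
      FrameTensor.inl_inf_inr]
    rw [← FrameTensor.eq_iSup_tmul T]
    refine le_antisymm (iSup₂_le fun p hp => FrameTensor.tmul_le.2 hp) ?_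
    rintro ⟨x, n⟩ hn
    obtain ⟨y, rfl⟩ := hg.surjective n
    exact FrameTensor.tmul_le.1 (le_iSup₂_of_le (x, y) hn le_rfl)
  map_eq_bot := by
    rw [FrameTensor.lTensor, FrameTensor.lift_inr, FrameHom.comp_apply, hg.map_eq_bot, map_bot]
  le_sup_of_map_le {S S'} h := by
    -- Once this holds, the image of `S` is also below the pushed downset; testing that at `(x, g
    -- y)` for `(x, y)` in `S` returns `(x, y)` to `S' ⊔ 1 ⊗ m`.
    have hle : FrameTensor.lTensor L g S' ≤
        hg.pushTensor (S' ⊔ FrameTensor.inr m) le_sup_right := by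
      refine iSup₂_le fun p hp => ?_
      rw [FrameHom.comp_apply, FrameTensor.inl_inf_inr, FrameTensor.tmul_le]
      change ∀ y, g y ≤ g p.2 → (p.1, y) ∈ (S' ⊔ FrameTensor.inr m).carrier
      intro y hy
      have hy' := hg.le_sup_of_map_le hy
      refine FrameTensor.lower _ (a := (p.1, p.2 ⊔ m)) ⟨le_rfl, hy'⟩ ?_
      rw [← sSup_pair (a := p.2)]
      refine FrameTensor.sSup_right_mem _ _ _ ?_
      rintro z (rfl | rfl)
      · exact (le_sup_left : S' ≤ S' ⊔ FrameTensor.inr m) hp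
      · exact FrameTensor.lower _ (a := (⊤, z)) ⟨le_top, le_rfl⟩ (FrameTensor.tmul_le.1
          (le_sup_right : FrameTensor.inr z ≤ S' ⊔ FrameTensor.inr z))
    rintro ⟨x, y⟩ hp
    have hxy : (x, g y) ∈ (FrameTensor.lTensor L g S).carrier := by
      rw [← FrameTensor.tmul_le, ← FrameTensor.inl_inf_inr]
      exact le_iSup₂_of_le (f := fun (p : L × M) (_ : p ∈ S.carrier) =>
        FrameTensor.inl p.1 ⊓ (FrameTensor.inr.comp g) p.2) (x, y) hp le_rfl
    have := hle (h hxy)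
    change ∀ z, g z ≤ g y → (x, z) ∈ (S' ⊔ FrameTensor.inr m).carrier at this
    exact this y le_rfl

end Tensor

/-- Opens of the subspace are restrictions, and an inclusion between restrictions can fail in the
ambient space only off the range, which is the open set joined on. -/
theorem comap {X Y : Type*} [TopologicalSpace X] [TopologicalSpace Y] (f : C(X, Y))
    (hf : Topology.IsClosedEmbedding f) :
    (Opens.comap f).IsClosedQuotient ⟨(Set.range f)ᶜ, hf.isClosed_range.isOpen_compl⟩ where
  surjective U := by
    obtain ⟨V, hV, h⟩ := hf.isInducing.isOpen_iff.1 U.isOpen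
    exact ⟨⟨V, hV⟩, Opens.ext h⟩
  map_eq_bot := by
    ext x
    simp
  le_sup_of_map_le {V V'} h y hy := by
    by_cases hr : y ∈ Set.range f
    · obtain ⟨x, rfl⟩ := hr
      exact Or.inl (h (x := x) hy)
    · exact Or.inr hr

/-! ### Gluing a frame from two closed quotients. -/

section Pullback

variable {F A B C : Type u} [Order.Frame F] [Order.Frame A] [Order.Frame B] [Order.Frame C]
  {p : FrameHom F A} {q : FrameHom F B} {p' : FrameHom A C} {q' : FrameHom B C} {u' v' : F}

/-- Distributivity: `x ≤ (y ⊔ u') ⊓ (y ⊔ v') = y ⊔ (u' ⊓ v') = y`. -/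
theorem eq_of_map_eq (hp : p.IsClosedQuotient u') (hq : q.IsClosedQuotient v')
    (huv : u' ⊓ v' = ⊥) {x y : F} (h₁ : p x = p y) (h₂ : q x = q y) : x = y := by
  have key : ∀ {x y : F}, p x = p y → q x = q y → x ≤ y := fun {x y} h₁ h₂ => by
    have := le_inf (hp.le_sup_of_map_le h₁.le) (hq.le_sup_of_map_le h₂.le)
    rwa [← sup_inf_left, huv, sup_bot_eq] at this
  exact le_antisymm (key h₁ h₂) (key h₁.symm h₂.symm)

theorem exists_map_eq (hp : p.IsClosedQuotient u') (hq : q.IsClosedQuotient v')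
    (comm : p'.comp p = q'.comp q) (hr : (p'.comp p).IsClosedQuotient (u' ⊔ v'))
    {α : A} {β : B} (h : p' α = q' β) : ∃ x, p x = α ∧ q x = β := by
  obtain ⟨P, rfl⟩ := hp.surjective α
  obtain ⟨Q, rfl⟩ := hq.surjective β
  have hPQ : (p'.comp p) P = (p'.comp p) Q := h.trans (DFunLike.congr_fun comm Q).symm
  -- `p` kills `u'`, so the image is `p P ⊓ (p Q ⊔ p v')`. This is `p P`, because agreement on the
  -- common quotient gives `P ≤ Q ⊔ (u' ⊔ v')`. The case of `q` is symmetric.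
  refine ⟨(P ⊔ u') ⊓ (Q ⊔ v'), ?_, ?_⟩
  · have h₁ := OrderHomClass.mono p (hr.le_sup_of_map_le hPQ.le)
    simp only [map_sup, map_inf, hp.map_eq_bot, sup_bot_eq, bot_sup_eq] at h₁ ⊢
    exact inf_eq_left.2 h₁
  · have h₁ := OrderHomClass.mono q (hr.le_sup_of_map_le hPQ.ge)
    simp only [map_sup, map_inf, hq.map_eq_bot, sup_bot_eq] at h₁ ⊢
    exact inf_eq_right.2 h₁

/-- A frame is glued from two complementary closed quotients along their common quotient. -/
theorem isPullback (hp : p.IsClosedQuotient u') (hq : q.IsClosedQuotient v')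
    (huv : u' ⊓ v' = ⊥) (comm : p'.comp p = q'.comp q)
    (hr : (p'.comp p).IsClosedQuotient (u' ⊔ v')) :
    IsPullback (Frm.ofHom p) (Frm.ofHom q) (Frm.ofHom p') (Frm.ofHom q') := by
  have hinj : ∀ {x y : F}, p x = p y → q x = q y → x = y := hp.eq_of_map_eq hq huv
  refine ⟨⟨congrArg Frm.ofHom comm⟩, ⟨PullbackCone.IsLimit.mk _ (fun s => Frm.ofHom ?_) ?_ ?_ ?_⟩⟩
  · have hs (x : s.pt) : ∃ y, p y = s.fst.hom x ∧ q y = s.snd.hom x := hp.exists_map_eq hq comm hr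
      (DFunLike.congr_fun (congrArg Frm.Hom.hom s.condition) x)
    choose φ h₁ h₂ using hs
    -- Pointwise choices preserve finite meets and joins because `p` and `q` are jointly injective.
    exact
      { toFun := φ
        map_inf' := fun x y => hinj (by simp [h₁]) (by simp [h₂])
        map_top' := hinj (by simp [h₁]) (by simp [h₂])
        map_sSup' := fun X => hinj
          (by simp only [h₁, map_sSup, Set.image_image])
          (by simp only [h₂, map_sSup, Set.image_image]) }
  · intro s
    ext x
    exact (hp.exists_map_eq hq comm hr
      (DFunLike.congr_fun (congrArg Frm.Hom.hom s.condition) x)).choose_spec.1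
  · intro s
    ext x
    exact (hp.exists_map_eq hq comm hr
      (DFunLike.congr_fun (congrArg Frm.Hom.hom s.condition) x)).choose_spec.2
  · intro s f h₁ h₂
    ext x
    have hx := (hp.exists_map_eq hq comm hr
      (DFunLike.congr_fun (congrArg Frm.Hom.hom s.condition) x)).choose_spec
    exact hinj ((DFunLike.congr_fun (congrArg Frm.Hom.hom h₁) x).trans hx.1.symm)
      ((DFunLike.congr_fun (congrArg Frm.Hom.hom h₂) x).trans hx.2.symm)

end Pullback

end FrameHom.IsClosedQuotient

namespace FrameTensor

theorem lTensor_comp {M N K : Type*} [Order.Frame M] [Order.Frame N] [Order.Frame K]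
    (L : Type*) [Order.Frame L] (h : FrameHom N K) (g : FrameHom M N) :
    (lTensor L h).comp (lTensor L g) = lTensor L (h.comp g) :=
  hom_ext' (fun x => by simp [lTensor, lift_inl]) (fun y => by simp [lTensor, lift_inr])

end FrameTensor

/-! ### Closed covers of spaces and their frames of opens. -/

/-- A square of closed embeddings of spaces which exhibits its corner `W` as the union of two closed
subspaces `X` and `Y` with intersection `Z`. -/
structure IsClosedCoverSquare {Z X Y W : TopCat.{u}} (f : Z ⟶ X) (g : Z ⟶ Y) (i : X ⟶ W)
    (j : Y ⟶ W) : Prop where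
  w : f ≫ i = g ≫ j
  left : Topology.IsClosedEmbedding i
  right : Topology.IsClosedEmbedding j
  diag : Topology.IsClosedEmbedding (f ≫ i)
  union : Set.range i ∪ Set.range j = Set.univ
  inter : Set.range i ∩ Set.range j = Set.range (f ≫ i)

namespace IsClosedCoverSquare

variable {Z X Y W : TopCat.{u}} {f : Z ⟶ X} {g : Z ⟶ Y} {i : X ⟶ W} {j : Y ⟶ W}

theorem exists_of_eq (h : IsClosedCoverSquare f g i j) {x : X} {y : Y} (hxy : i x = j y) :
    ∃ z, f z = x ∧ g z = y := by
  obtain ⟨z, hz⟩ : i x ∈ Set.range (f ≫ i) := h.inter ▸ ⟨⟨x, rfl⟩, ⟨y, hxy.symm⟩⟩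
  refine ⟨z, h.left.injective hz, h.right.injective ?_⟩
  exact (ConcreteCategory.congr_hom h.w z).symm.trans (hz.trans hxy)

theorem exists_desc (h : IsClosedCoverSquare f g i j) {T : TopCat.{u}} (k : X ⟶ T) (l : Y ⟶ T)
    (hkl : f ≫ k = g ≫ l) : ∃ d : W ⟶ T, i ≫ d = k ∧ j ≫ d = l := by
  have hex (w : W) : ∃ t, (∀ x, i x = w → k x = t) ∧ ∀ y, j y = w → l y = t := by
    have hkl' {x y} (hxy : i x = j y) : k x = l y := by
      obtain ⟨z, rfl, rfl⟩ := h.exists_of_eq hxy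
      exact ConcreteCategory.congr_hom hkl z
    rcases h.union.ge (Set.mem_univ w) with ⟨x, rfl⟩ | ⟨y, rfl⟩
    · exact ⟨k x, fun x' hx' => congrArg k (h.left.injective hx'),
        fun y hy => (hkl' hy.symm).symm⟩
    · exact ⟨l y, fun x hx => hkl' hx, fun y' hy' => congrArg l (h.right.injective hy')⟩
  choose d hd₁ hd₂ using hex
  have hd : Continuous d := by
    refine continuous_iff_isClosed.2 fun C hC => ?_
    -- Pasting: the preimage of a closed set is a union of two closed images, since `i` and `j` are
    -- closed maps.
    have : d ⁻¹' C = i '' (k ⁻¹' C) ∪ j '' (l ⁻¹' C) := by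
      ext w
      constructor
      · intro hw
        rcases h.union.ge (Set.mem_univ w) with ⟨x, rfl⟩ | ⟨y, rfl⟩
        · exact Or.inl ⟨x, (hd₁ _ x rfl ▸ hw : k x ∈ C), rfl⟩
        · exact Or.inr ⟨y, (hd₂ _ y rfl ▸ hw : l y ∈ C), rfl⟩
      · rintro (⟨x, hx, rfl⟩ | ⟨y, hy, rfl⟩)
        · exact (hd₁ _ x rfl ▸ hx : d (i x) ∈ C)
        · exact (hd₂ _ y rfl ▸ hy : d (j y) ∈ C)
    rw [this]
    exact (h.left.isClosedMap _ (hC.preimage k.hom.continuous)).union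
      (h.right.isClosedMap _ (hC.preimage l.hom.continuous))
  exact ⟨TopCat.ofHom ⟨d, hd⟩, by ext x; exact (hd₁ _ x rfl).symm,
    by ext y; exact (hd₂ _ y rfl).symm⟩

theorem isPushout (h : IsClosedCoverSquare f g i j) : IsPushout f g i j := by
  refine ⟨⟨h.w⟩, ⟨PushoutCocone.IsColimit.mk _
    (fun s => (h.exists_desc s.inl s.inr s.condition).choose)
    (fun s => (h.exists_desc s.inl s.inr s.condition).choose_spec.1)
    (fun s => (h.exists_desc s.inl s.inr s.condition).choose_spec.2) ?_⟩⟩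
  intro s d hd₁ hd₂
  have hs := (h.exists_desc s.inl s.inr s.condition).choose_spec
  ext w
  rcases h.union.ge (Set.mem_univ w) with ⟨x, rfl⟩ | ⟨y, rfl⟩
  · exact ConcreteCategory.congr_hom (hd₁.trans hs.1.symm) x
  · exact ConcreteCategory.congr_hom (hd₂.trans hs.2.symm) y

theorem compl_inf_compl (h : IsClosedCoverSquare f g i j) :
    (⟨(Set.range i)ᶜ, h.left.isClosed_range.isOpen_compl⟩ : Opens W) ⊓
      ⟨(Set.range j)ᶜ, h.right.isClosed_range.isOpen_compl⟩ = ⊥ :=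
  Opens.ext <| by
    change (Set.range i)ᶜ ∩ (Set.range j)ᶜ = ∅
    rw [← Set.compl_union, h.union, Set.compl_univ]

theorem compl_sup_compl (h : IsClosedCoverSquare f g i j) :
    (⟨(Set.range i)ᶜ, h.left.isClosed_range.isOpen_compl⟩ : Opens W) ⊔
      ⟨(Set.range j)ᶜ, h.right.isClosed_range.isOpen_compl⟩ =
      ⟨(Set.range (f ≫ i))ᶜ, h.diag.isClosed_range.isOpen_compl⟩ :=
  Opens.ext <| by
    change (Set.range i)ᶜ ∪ (Set.range j)ᶜ = (Set.range (f ≫ i))ᶜ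
    rw [← Set.compl_inter, h.inter]

theorem comap_comp_comap (h : IsClosedCoverSquare f g i j) :
    (Opens.comap f.hom).comp (Opens.comap i.hom) = (Opens.comap g.hom).comp (Opens.comap j.hom) :=
  congrArg (fun k : Z ⟶ W => Opens.comap k.hom) h.w

theorem isPullback_comap (h : IsClosedCoverSquare f g i j) :
    IsPullback (Frm.ofHom (Opens.comap i.hom)) (Frm.ofHom (Opens.comap j.hom))
      (Frm.ofHom (Opens.comap f.hom)) (Frm.ofHom (Opens.comap g.hom)) :=
  (FrameHom.IsClosedQuotient.comap i.hom h.left).isPullback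
    (FrameHom.IsClosedQuotient.comap j.hom h.right) h.compl_inf_compl h.comap_comp_comap
    (h.compl_sup_compl ▸ FrameHom.IsClosedQuotient.comap (f ≫ i).hom h.diag)

theorem isPullback_lTensor (h : IsClosedCoverSquare f g i j) (L : Type u) [Order.Frame L] :
    IsPullback (Frm.ofHom (FrameTensor.lTensor L (Opens.comap i.hom)))
      (Frm.ofHom (FrameTensor.lTensor L (Opens.comap j.hom)))
      (Frm.ofHom (FrameTensor.lTensor L (Opens.comap f.hom)))
      (Frm.ofHom (FrameTensor.lTensor L (Opens.comap g.hom))) := by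
  refine ((FrameHom.IsClosedQuotient.comap i.hom h.left).lTensor L).isPullback
    ((FrameHom.IsClosedQuotient.comap j.hom h.right).lTensor L) ?_ ?_ ?_
  · rw [← map_inf, h.compl_inf_compl, map_bot]
  · rw [FrameTensor.lTensor_comp, FrameTensor.lTensor_comp, h.comap_comp_comap]
  · rw [← map_sup, h.compl_sup_compl, FrameTensor.lTensor_comp]
    exact (FrameHom.IsClosedQuotient.comap (f ≫ i).hom h.diag).lTensor L

theorem isPushout_topToLocale (h : IsClosedCoverSquare f g i j) :
    IsPushout (topToLocale.map f) (topToLocale.map g) (topToLocale.map i) (topToLocale.map j) :=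
  h.isPullback_comap.flip.op

end IsClosedCoverSquare

/-! ### Products of locales as tensor products of frames. -/

namespace FrameTensor

/-- The product of locales is the coproduct of frames. -/
noncomputable def prodIso (L M : Locale.{u}) : L ⨯ M ≅ Locale.of (FrameTensor L M) :=
  (limit.isLimit (pair L M)).conePointUniqueUpToIso
    (BinaryCofan.IsColimit.op (isColimit L.unop M.unop))

end FrameTensor

namespace FrameTensor

/-- The first projection from the product of locales given by the tensor product of frames. -/
def fst (L M : Locale.{u}) : Locale.of (FrameTensor L M) ⟶ L :=
  (Frm.ofHom inl : L.unop ⟶ Frm.of (FrameTensor L M)).op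

/-- The second projection from the product of locales given by the tensor product of frames. -/
def snd (L M : Locale.{u}) : Locale.of (FrameTensor L M) ⟶ M :=
  (Frm.ofHom inr : M.unop ⟶ Frm.of (FrameTensor L M)).op

theorem prodIso_hom_fst (L M : Locale.{u}) : (prodIso L M).hom ≫ fst L M = prod.fst :=
  IsLimit.conePointUniqueUpToIso_hom_comp _ _ (Discrete.mk WalkingPair.left)

theorem prodIso_hom_snd (L M : Locale.{u}) : (prodIso L M).hom ≫ snd L M = prod.snd :=
  IsLimit.conePointUniqueUpToIso_hom_comp _ _ (Discrete.mk WalkingPair.right)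

/-- The morphism of locales `id × φ`, realized on the tensor products of frames. -/
def mapRight (L : Locale.{u}) {M N : Locale.{u}} (φ : M ⟶ N) :
    Locale.of (FrameTensor L M) ⟶ Locale.of (FrameTensor L N) :=
  (Frm.ofHom (lTensor L φ.unop.hom)).op

theorem mapRight_fst (L : Locale.{u}) {M N : Locale.{u}} (φ : M ⟶ N) :
    mapRight L φ ≫ fst L N = fst L M :=
  Quiver.Hom.unop_inj (Frm.ext fun x => lift_inl _ _ x)

theorem mapRight_snd (L : Locale.{u}) {M N : Locale.{u}} (φ : M ⟶ N) :
    mapRight L φ ≫ snd L N = snd L M ≫ φ :=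
  Quiver.Hom.unop_inj (Frm.ext fun y => lift_inr _ _ y)

/-- Naturality of `prodIso` in the second factor, needed to carry the tensor square over to the
categorical product. -/
theorem prod_map_comp_prodIso_hom (L : Locale.{u}) {M N : Locale.{u}} (φ : M ⟶ N) :
    prod.map (𝟙 L) φ ≫ (prodIso L N).hom = (prodIso L M).hom ≫ mapRight L φ := by
  rw [← Iso.eq_comp_inv]
  apply Limits.prod.hom_ext
  · rw [prod.map_fst, Category.comp_id, Category.assoc, Category.assoc,
      (Iso.inv_comp_eq _).2 (prodIso_hom_fst L N).symm, mapRight_fst, prodIso_hom_fst]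
  · rw [prod.map_snd, Category.assoc, Category.assoc,
      (Iso.inv_comp_eq _).2 (prodIso_hom_snd L N).symm, mapRight_snd, ← Category.assoc,
      prodIso_hom_snd]

end FrameTensor

theorem IsClosedCoverSquare.isPushout_prod {Z X Y W : TopCat.{u}} {f : Z ⟶ X} {g : Z ⟶ Y}
    {i : X ⟶ W} {j : Y ⟶ W} (h : IsClosedCoverSquare f g i j) (L : Locale.{u}) :
    IsPushout (prod.map (𝟙 L) (topToLocale.map f)) (prod.map (𝟙 L) (topToLocale.map g))
      (prod.map (𝟙 L) (topToLocale.map i)) (prod.map (𝟙 L) (topToLocale.map j)) := by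
  have hT : IsPushout (FrameTensor.mapRight L (topToLocale.map f))
      (FrameTensor.mapRight L (topToLocale.map g)) (FrameTensor.mapRight L (topToLocale.map i))
      (FrameTensor.mapRight L (topToLocale.map j)) := (h.isPullback_lTensor L).flip.op
  exact hT.of_iso' (FrameTensor.prodIso L _) (FrameTensor.prodIso L _) (FrameTensor.prodIso L _)
    (FrameTensor.prodIso L _) (FrameTensor.prod_map_comp_prodIso_hom L _).symm
    (FrameTensor.prod_map_comp_prodIso_hom L _).symm
    (FrameTensor.prod_map_comp_prodIso_hom L _).symm
    (FrameTensor.prod_map_comp_prodIso_hom L _).symm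

/-! ### The two halves of the unit interval. -/

namespace UnitInterval

instance : CompactSpace TopCat.I.{u} := TopCat.I.homeomorph.symm.compactSpace

instance : T2Space TopCat.I.{u} := TopCat.I.homeomorph.symm.t2Space

theorem coe_a (t : TopCat.I.{u}) :
    (TopCat.I.homeomorph (a t) : ℝ) = (TopCat.I.homeomorph t : ℝ) / 2 := rfl

theorem coe_b (t : TopCat.I.{u}) :
    (TopCat.I.homeomorph (b t) : ℝ) = ((TopCat.I.homeomorph t : ℝ) + 1) / 2 := rfl

theorem ext_coe {s t : TopCat.I.{u}}
    (h : (TopCat.I.homeomorph s : ℝ) = (TopCat.I.homeomorph t : ℝ)) : s = t :=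
  TopCat.I.ext (Subtype.ext h)

theorem coe_zero : (TopCat.I.homeomorph (0 : TopCat.I.{u}) : ℝ) = 0 := by simp

theorem coe_one : (TopCat.I.homeomorph (1 : TopCat.I.{u}) : ℝ) = 1 := by simp

theorem a_zero : a.{u} 0 = 0 := ext_coe (by rw [coe_a, coe_zero, zero_div])

theorem b_one : b.{u} 1 = 1 := ext_coe (by rw [coe_b, coe_one]; norm_num)

theorem a_one : a.{u} 1 = b 0 := ext_coe (by rw [coe_a, coe_b, coe_one, coe_zero]; norm_num)

theorem mem_range_a {t : TopCat.I.{u}} :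
    t ∈ Set.range a ↔ (TopCat.I.homeomorph t : ℝ) ≤ 1 / 2 := by
  constructor
  · rintro ⟨s, rfl⟩
    rw [coe_a]
    linarith [(TopCat.I.homeomorph s).2.2]
  · intro h
    have h₀ := (TopCat.I.homeomorph t).2.1
    refine ⟨TopCat.I.homeomorph.symm
      ⟨2 * (TopCat.I.homeomorph t : ℝ), by constructor <;> linarith⟩, ext_coe ?_⟩
    rw [coe_a, Homeomorph.apply_symm_apply]
    ring

theorem mem_range_b {t : TopCat.I.{u}} :
    t ∈ Set.range b ↔ 1 / 2 ≤ (TopCat.I.homeomorph t : ℝ) := by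
  constructor
  · rintro ⟨s, rfl⟩
    rw [coe_b]
    linarith [(TopCat.I.homeomorph s).2.1]
  · intro h
    have h₁ := (TopCat.I.homeomorph t).2.2
    refine ⟨TopCat.I.homeomorph.symm
      ⟨2 * (TopCat.I.homeomorph t : ℝ) - 1, by constructor <;> linarith⟩, ext_coe ?_⟩
    rw [coe_b, Homeomorph.apply_symm_apply]
    ring

theorem isClosedCoverSquare : IsClosedCoverSquare e₁.{u} e₀.{u} a.{u} b.{u} where
  w := by
    ext x
    exact congrArg (fun t => (TopCat.I.homeomorph t : ℝ)) a_one
  -- A continuous injection from a compact space to a Hausdorff space is a closed embedding.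
  left := a.hom.continuous.isClosedEmbedding fun s t h => ext_coe (by
    have := congrArg (fun r => (TopCat.I.homeomorph r : ℝ)) h
    simp only [coe_a] at this
    linarith)
  right := b.hom.continuous.isClosedEmbedding fun s t h => ext_coe (by
    have := congrArg (fun r => (TopCat.I.homeomorph r : ℝ)) h
    simp only [coe_b] at this
    linarith)
  diag := (e₁ ≫ a).hom.continuous.isClosedEmbedding fun _ _ _ => rfl
  union := Set.eq_univ_of_forall fun t =>
    (le_total (TopCat.I.homeomorph t : ℝ) (1 / 2)).imp mem_range_a.2 mem_range_b.2
  inter := by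
    have h₁ : (TopCat.I.homeomorph (a.{u} 1) : ℝ) = 1 / 2 := by rw [coe_a, coe_one]
    ext t
    rw [Set.mem_inter_iff, mem_range_a, mem_range_b]
    constructor
    · rintro ⟨h, h'⟩
      exact ⟨PUnit.unit, ext_coe (h₁.trans (le_antisymm h' h))⟩
    · rintro ⟨_, rfl⟩
      exact ⟨h₁.le, h₁.ge⟩

theorem isPullback_chi (L : Type u) [Order.Frame L] :
    IsPullback
      (Frm.ofHom (FrameTensor.lTensor L (Opens.comap a.{u}.hom)))
      (Frm.ofHom (FrameTensor.lTensor L (Opens.comap b.{u}.hom)))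
      (Frm.ofHom (chi L e₁.{u})) (Frm.ofHom (chi L e₀.{u})) := by
  have h := isClosedCoverSquare.{u}.isPullback_lTensor L
  -- Only the corner `L ⊗ Ω*` changes; `chi` is by definition `id ⊗ e⁻¹` followed by `rightUnit`, so
  -- every compatibility is definitional.
  refine h.of_iso (Iso.refl _) (Iso.refl _) (Iso.refl _)
    (Frm.Iso.mk (FrameTensor.rightUnit.{u, u} L)) ?_ ?_ ?_ ?_ <;> rfl

end UnitInterval

theorem mainTheorem10 :
    -- the pullback square of frames
    (∀ (L : Type u) [Order.Frame L],
      IsPullback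
        (Frm.ofHom (FrameTensor.lTensor L (Opens.comap UnitInterval.a.{u}.hom)))
        (Frm.ofHom (FrameTensor.lTensor L (Opens.comap UnitInterval.b.{u}.hom)))
        (Frm.ofHom (UnitInterval.chi L UnitInterval.e₁.{u}))
        (Frm.ofHom (UnitInterval.chi L UnitInterval.e₀.{u}))) ∧
    -- axiom (S3): the pushout of spaces, its preservation by `Ω`, and by products of locales
    (UnitInterval.a.{u} 0 = 0 ∧ UnitInterval.b.{u} 1 = 1 ∧
      IsPushout UnitInterval.e₁.{u} UnitInterval.e₀.{u} UnitInterval.a.{u} UnitInterval.b.{u} ∧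
      IsPushout (topToLocale.map UnitInterval.e₁.{u}) (topToLocale.map UnitInterval.e₀.{u})
        (topToLocale.map UnitInterval.a.{u}) (topToLocale.map UnitInterval.b.{u}) ∧
      ∀ L : Locale.{u},
        PreservesColimit
            (span (topToLocale.map UnitInterval.e₁.{u}) (topToLocale.map UnitInterval.e₀.{u}))
            (prod.functor.obj L) ∧
        IsPushout
          (prod.map (𝟙 L) (topToLocale.map UnitInterval.e₁.{u}))
          (prod.map (𝟙 L) (topToLocale.map UnitInterval.e₀.{u}))
          (prod.map (𝟙 L) (topToLocale.map UnitInterval.a.{u}))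
          (prod.map (𝟙 L) (topToLocale.map UnitInterval.b.{u}))) := by
  have h := UnitInterval.isClosedCoverSquare.{u}
  exact ⟨fun L _ => UnitInterval.isPullback_chi L, UnitInterval.a_zero, UnitInterval.b_one,
    h.isPushout, h.isPushout_topToLocale, fun L =>
      -- Preserving the colimit of a span can be tested on one pushout square, here the image of the
      -- interval square under `Ω`.
      ⟨(h.isPushout_topToLocale.preservesColimit_span_iff (F := prod.functor.obj L)).2
        (h.isPushout_prod L), h.isPushout_prod L⟩⟩
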